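/- Let $\mathcal V$ be a countably infinite set of names and $\mathfrak S(\mathcal V)$ the group of permutations of $\mathcal V$ generated by transpositions. A nominal set is a set with an action of $\mathfrak S(\mathcal V)$ in which every element $x$ is supported by some finite $S\subseteq\mathcal V$ (that is, $\pi\cdot x=x$ whenever $\pi$ fixes all elements of $S$). $\mathsf{Nom}$ is the category of nominal sets and equivariant maps; $0$ and $1$ denote the empty and the one-point nominal set. The internal hom $[X,Y]$ is the nominal set of functions $f:X\to Y$ that are finitely supported for the action $(\pi\cdot f)(x)=\pi\cdot f(\pi^{-1}\cdot x)$. A functor $F:\mathsf{Nom}\to\mathsf{Nom}$ is $\mathsf{Nom}$-enriched if there are equivariant maps $F_{X,Y}:[X,Y]\to[FX,FY]$ that agree with $F$ on equivariant maps and are compatible with composition. A nominal metric space is a nominal set $X$ with a metric $d:X\times X\to[0,1]$ such that $d(\pi\cdot x,\pi\cdot y)=d(x,y)$ for all $\pi,x,y$. A Cauchy sequence in $X$ is finitely supported if one finite set of names supports all its terms, and $X$ is complete if every finitely supported Cauchy sequence converges. A map $\iota:X\to Y$ in $\mathsf{Nom}$ between nominal metric spaces exhibits $Y$ as the nominal completion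 of $X$ if $Y$ is complete, $\iota$ is isometric, every element of $Y$ is the limit of the image of a finitely supported Cauchy sequence of $X$, and every equivariant uniformly continuous map from $X$ to a complete nominal metric space extends uniquely along $\iota$ to an equivariant uniformly continuous map on $Y$. **Theorem.** Let $F:\mathsf{Nom}\to\mathsf{Nom}$ be a functor that preserves limits of $\omega^{\mathrm{op}}$-chains and monomorphisms and such that $F0\neq 0$ (i.e. $F0\not\cong 0$). Assume further that $F$ is $\mathsf{Nom}$-enriched. Then $F$ has a final coalgebra $\tau:T\to FT$ and an initial algebra $\sigma:FI\to I$, both of which can be equipped with equivariant metrics with values in $[0,1]$, making them nominal metric spaces, and the final coalgebra is the nominal completion of the initial algebra. More precisely, let $p_n:T\to F^n1$ be given by the unique map $p_0:T\to 1$ and $p_{n+1}=F(p_n)\circ\tau$. The metric on $T$ can be taken to be $d(x,y)=2^{-\max\{n\,\mid\,p_nx=p_ny\}}$ for $x\neq y$ (the maximum exists), and the map exhibiting $T$ as the nominal completion of $I$ can be taken to be the canonical map $\iota:I\to T$, i.e. one with $\tau\circ\iota\circ\sigma=F\iota$. -/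

import Mathlib

open CategoryTheory CategoryTheory.Limits Filter Topology

universe v u

/-- The group of permutations of `V` generated by transpositions. -/
abbrev FinPerm (V : Type v) : Type v :=
  ↥(Subgroup.closure {σ : Equiv.Perm V |
    @Equiv.Perm.IsSwap V (Classical.decEq V) σ})

/-- `x` is finitely supported: some finite set `S` of names is such that every `π` fixing all
elements of `S` fixes `x`. -/
def IsFinSupported (V : Type v) {A : Type u} [MulAction (FinPerm V) A] (x : A) : Prop :=
  ∃ S : Finset V, MulAction.Supports (FinPerm V) (S : Set V) x

theorem IsFinSupported.smul {V : Type v} {A : Type u} [MulAction (FinPerm V) A] {x : A}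
    (h : IsFinSupported V x) (π : FinPerm V) : IsFinSupported V (π • x) := by
  classical
  obtain ⟨S, hS⟩ := h
  refine ⟨S.image (fun a => π • a), fun σ hσ => ?_⟩
  have h1 : (π⁻¹ * σ * π) • x = x := by
    apply hS
    intro a ha
    have h2 : σ • π • a = π • a := hσ (Finset.mem_coe.2 (Finset.mem_image_of_mem _ ha))
    rw [mul_smul, mul_smul, h2, inv_smul_smul]
  calc σ • π • x = π • ((π⁻¹ * σ * π) • x) := by simp [smul_smul, mul_assoc]
    _ = π • x := by rw [h1]

/-- Nominal sets over the set `V` of names. -/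
structure Nom (V : Type v) where
  carrier : Type u
  [action : MulAction (FinPerm V) carrier]
  finSupported : ∀ x : carrier, IsFinSupported V x

namespace Nom

variable {V : Type v}

instance : CoeSort (Nom.{v, u} V) (Type u) := ⟨Nom.carrier⟩

attribute [instance] Nom.action

/-- Morphisms of nominal sets: equivariant maps. -/
@[ext]
structure Hom (X Y : Nom.{v, u} V) where
  toMap : X →[FinPerm V] Y

instance : Category (Nom.{v, u} V) where
  Hom X Y := Hom X Y
  id X := ⟨MulActionHom.id (FinPerm V)⟩
  comp f g := ⟨g.toMap.comp f.toMap⟩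

instance : ConcreteCategory (Nom.{v, u} V) (fun X Y => X →[FinPerm V] Y) where
  hom f := f.toMap
  ofHom f := ⟨f⟩

/-- The empty nominal set. -/
def zero (V : Type v) : Nom.{v, u} V :=
  letI : MulAction (FinPerm V) PEmpty.{u + 1} :=
    { smul := fun _ x => x, one_smul := fun _ => rfl, mul_smul := fun _ _ _ => rfl }
  { carrier := PEmpty
    finSupported := fun x => x.elim }

/-- The one-point nominal set. -/
def one (V : Type v) : Nom.{v, u} V :=
  letI : MulAction (FinPerm V) PUnit.{u + 1} :=
    { smul := fun _ x => x, one_smul := fun _ => rfl, mul_smul := fun _ _ _ => rfl }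
  { carrier := PUnit
    finSupported := fun _ => ⟨∅, fun _ _ => rfl⟩ }

/-- The unique map into the one-point nominal set. -/
def toOne (X : Nom.{v, u} V) : X ⟶ one V :=
  ⟨{ toFun := fun _ => PUnit.unit, map_smul' := fun _ _ => rfl }⟩

/-- The empty nominal set is initial. -/
def zeroIsInitial (V : Type v) : IsInitial (zero.{v, u} V) :=
  IsInitial.ofUniqueHom
    (fun _ => ⟨{ toFun := fun x => PEmpty.elim x, map_smul' := fun _ x => PEmpty.elim x }⟩)
    (fun _ _ => Hom.ext (MulActionHom.ext fun x => PEmpty.elim x))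

/-- The one-point nominal set is terminal. -/
def oneIsTerminal (V : Type v) : IsTerminal (one.{v, u} V) :=
  IsTerminal.ofUniqueHom toOne (fun _ _ => rfl)

/-- All functions between two nominal sets, with the conjugation action. -/
def Fun (X Y : Nom.{v, u} V) : Type u := X → Y

/-- The action `(π • f) x = π • f (π⁻¹ • x)`. -/
instance (X Y : Nom.{v, u} V) : MulAction (FinPerm V) (Fun X Y) where
  smul π f := fun x => π • f (π⁻¹ • x)
  one_smul f := by
    funext x
    change (1 : FinPerm V) • f ((1 : FinPerm V)⁻¹ • x) = f x
    simp
  mul_smul π σ f := by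
    funext x
    change (π * σ) • f ((π * σ)⁻¹ • x) = π • σ • f (σ⁻¹ • π⁻¹ • x)
    simp [mul_smul]

/-- The internal hom: the nominal set of finitely supported functions. -/
def ihom (X Y : Nom.{v, u} V) : Nom.{v, u} V :=
  letI : MulAction (FinPerm V) {f : Fun X Y // IsFinSupported V f} :=
    { smul := fun π f => ⟨π • f.1, f.2.smul π⟩
      one_smul := fun f => Subtype.ext (one_smul _ f.1)
      mul_smul := fun π σ f => Subtype.ext (mul_smul π σ f.1) }
  { carrier := {f : Fun X Y // IsFinSupported V f}
    finSupported := fun f => by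
      obtain ⟨S, hS⟩ := f.2
      exact ⟨S, fun π hπ => Subtype.ext (hS π hπ)⟩ }

/-- An equivariant map, as an element of the internal hom. -/
def ihomOfHom {X Y : Nom.{v, u} V} (f : X ⟶ Y) : ihom X Y :=
  ⟨fun x => f x, ∅, fun π _ => by
    funext x
    change π • f.toMap (π⁻¹ • x) = f.toMap x
    rw [map_smul, smul_inv_smul]⟩

/-- Composition of finitely supported functions. -/
def ihomComp {X Y Z : Nom.{v, u} V} (g : ihom Y Z) (f : ihom X Y) : ihom X Z :=
  ⟨fun x => g.1 (f.1 x), by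
    classical
    obtain ⟨S, hS⟩ := g.2
    obtain ⟨R, hR⟩ := f.2
    refine ⟨S ∪ R, fun π hπ => ?_⟩
    have h1 : π • g.1 = g.1 := hS π fun a ha => hπ (by simp_all)
    have h2 : π • f.1 = f.1 := hR π fun a ha => hπ (by simp_all)
    funext x
    change π • g.1 (f.1 (π⁻¹ • x)) = g.1 (f.1 x)
    have h3 : π • f.1 (π⁻¹ • x) = f.1 x := congrFun h2 x
    have h4 : π • g.1 (π⁻¹ • f.1 x) = g.1 (f.1 x) := congrFun h1 (f.1 x)
    rw [← h4, ← h3, inv_smul_smul]⟩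

/-- A `Nom`-enrichment of an endofunctor `F`: equivariant maps `[X, Y] → [F X, F Y]` that are
compatible with composition and restrict to the action of `F` on equivariant maps (in particular
they preserve identities). -/
structure Enrichment (F : Nom.{v, u} V ⥤ Nom.{v, u} V) where
  map : ∀ X Y : Nom.{v, u} V, ihom X Y ⟶ ihom (F.obj X) (F.obj Y)
  map_ofHom : ∀ {X Y : Nom.{v, u} V} (f : X ⟶ Y), map X Y (ihomOfHom f) = ihomOfHom (F.map f)
  map_comp : ∀ {X Y Z : Nom.{v, u} V} (g : ihom Y Z) (f : ihom X Y),
    map X Z (ihomComp g f) = ihomComp (map Y Z g) (map X Y f)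

/-- The object `Fⁿ 1` of the final sequence of `F`. -/
def finalSeq (F : Nom.{v, u} V ⥤ Nom.{v, u} V) : ℕ → Nom.{v, u} V
  | 0 => one V
  | n + 1 => F.obj (finalSeq F n)

/-- The canonical map `pₙ : T ⟶ Fⁿ 1` of an `F`-coalgebra `T` to the final sequence. -/
def proj {F : Nom.{v, u} V ⥤ Nom.{v, u} V} (T : Endofunctor.Coalgebra F) :
    ∀ n : ℕ, T.V ⟶ finalSeq F n
  | 0 => toOne T.V
  | n + 1 => T.str ≫ F.map (proj T n)

/-- The metric makes `X` a nominal metric space: it is equivariant with values in `[0, 1]`. -/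
structure IsNominalMetric (X : Nom.{v, u} V) [MetricSpace X] : Prop where
  dist_le_one : ∀ x y : X, dist x y ≤ 1
  dist_smul : ∀ (π : FinPerm V) (x y : X), dist (π • x) (π • y) = dist x y

/-- Finitely supported Cauchy sequences: one finite set of names supports all the terms. -/
def IsFinSupportedCauchySeq {X : Nom.{v, u} V} [MetricSpace X] (x : ℕ → X) : Prop :=
  CauchySeq x ∧ ∃ S : Finset V, ∀ n, MulAction.Supports (FinPerm V) (S : Set V) (x n)

/-- Completeness of nominal metric spaces. -/
def IsNominalComplete (X : Nom.{v, u} V) [MetricSpace X] : Prop :=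
  ∀ x : ℕ → X, IsFinSupportedCauchySeq x → ∃ l : X, Tendsto x atTop (𝓝 l)

/-- `ι : X ⟶ Y` exhibits `Y` as the nominal completion of `X`: `Y` is complete, `ι` is an isometric
embedding, `Y` consists of the limits of the finitely supported Cauchy sequences of `X`, and
equivariant uniformly continuous maps from `X` to complete nominal metric spaces extend uniquely
along `ι`. -/
structure IsNominalCompletion {X Y : Nom.{v, u} V} [MetricSpace X] [MetricSpace Y]
    (ι : X ⟶ Y) : Prop where
  complete : IsNominalComplete Y
  isometry : Isometry ι
  exists_seq : ∀ y : Y, ∃ x : ℕ → X, IsFinSupportedCauchySeq x ∧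
    Tendsto (fun n => ι (x n)) atTop (𝓝 y)
  exists_unique_extension : ∀ (Z : Nom.{v, u} V) [MetricSpace Z], IsNominalMetric Z →
    IsNominalComplete Z → ∀ f : X ⟶ Z, UniformContinuous f →
      ∃! g : Y ⟶ Z, UniformContinuous g ∧ ι ≫ g = f

end Nom

/-! ### Nominal subsets, monomorphisms, factorizations -/

namespace Nom

variable {V : Type v}

/-! `T` is the limit of the final sequence: `F` preserves it, so the shifted projections give the
structure map (`finalCoalgIsTerminal`). The initial algebra is found inside `T` without transfinite
iteration. Zorn's lemma yields a maximal recursive subcoalgebra `s`; the preimage under `τ` of `F s`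
is recursive too and contains `s`, so it equals `s`. Hence `s ≅ F s`, and a recursive coalgebra with
invertible structure is an initial algebra (`exists_initial_algebra`).

The closed ball of radius `2⁻ⁿ` in `T` is a fibre of `pₙ`, and `I` carries the induced metric.
Density is where the enrichment enters. A point of `F 0` gives a point `a` of `I`, which need not be
equivariant, so the constant map `1 → I` at `a` is only finitely supported. The enrichment still
allows `F` to be iterated on it, giving maps `sₙ : Fⁿ 1 → I`, all supported by a support of `a`,
with `pₙ ∘ ι ∘ sₙ = id` (`ihomComp_algSection`). Thus `ι (sₙ (pₙ y))` lies within `2⁻ⁿ` of `y`, with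
supports bounded by those of `a` and `y`. The universal property is then extension by limits. -/

theorem hom_smul {X Y : Nom.{v, u} V} (f : X ⟶ Y) (π : FinPerm V) (x : X) :
    f (π • x) = π • f x :=
  map_smul f.toMap π x

theorem hom_ext {X Y : Nom.{v, u} V} {f g : X ⟶ Y} (h : ∀ x, f x = g x) : f = g :=
  Hom.ext (MulActionHom.ext h)

theorem comp_app {X Y Z : Nom.{v, u} V} (f : X ⟶ Y) (g : Y ⟶ Z) (x : X) :
    (f ≫ g) x = g (f x) := rfl

theorem hom_congr {X Y : Nom.{v, u} V} {f g : X ⟶ Y} (h : f = g) (x : X) : f x = g x := by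
  rw [h]

/-- An equivariant map preserves supports. -/
theorem supports_hom {X Y : Nom.{v, u} V} (f : X ⟶ Y) {S : Set V} {x : X}
    (h : MulAction.Supports (FinPerm V) S x) : MulAction.Supports (FinPerm V) S (f x) :=
  fun π hπ => by rw [← hom_smul, h π hπ]

/-- A nominal subset. -/
def sub (X : Nom.{v, u} V) (s : SubMulAction (FinPerm V) X) : Nom.{v, u} V where
  carrier := s
  finSupported x := by
    obtain ⟨S, hS⟩ := X.finSupported x.1
    exact ⟨S, fun π hπ => Subtype.ext (hS π hπ)⟩

/-- The inclusion of a nominal subset. -/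
def incl {X : Nom.{v, u} V} (s : SubMulAction (FinPerm V) X) : sub X s ⟶ X :=
  ⟨{ toFun := Subtype.val, map_smul' := fun _ _ => rfl }⟩

/-- Corestriction of an equivariant map to a nominal subset. -/
def codRestrict {X Y : Nom.{v, u} V} (s : SubMulAction (FinPerm V) X) (f : Y ⟶ X)
    (h : ∀ y, f y ∈ s) : Y ⟶ sub X s :=
  ⟨{ toFun := fun y => ⟨f y, h y⟩, map_smul' := fun π y => Subtype.ext (hom_smul f π y) }⟩

/-- The inclusion between nominal subsets. -/
def inclLE {X : Nom.{v, u} V} {s t : SubMulAction (FinPerm V) X} (h : s ≤ t) :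
    sub X s ⟶ sub X t :=
  codRestrict t (incl s) fun y => h y.2

theorem inclLE_incl {X : Nom.{v, u} V} {s t : SubMulAction (FinPerm V) X} (h : s ≤ t) :
    inclLE h ≫ incl t = incl s := rfl

theorem incl_injective {X : Nom.{v, u} V} (s : SubMulAction (FinPerm V) X) :
    Function.Injective (incl s) := Subtype.val_injective

theorem mono_of_injective {X Y : Nom.{v, u} V} (f : X ⟶ Y) (h : Function.Injective f) :
    Mono f :=
  ⟨fun _ _ e => hom_ext fun x => h (hom_congr e x)⟩

instance {X : Nom.{v, u} V} (s : SubMulAction (FinPerm V) X) : Mono (incl s) :=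
  mono_of_injective _ (incl_injective s)

/-- The kernel pair of an equivariant map. -/
def kerPair {X Y : Nom.{v, u} V} (f : X ⟶ Y) : Nom.{v, u} V :=
  letI : MulAction (FinPerm V) {p : X × X // f p.1 = f p.2} :=
    { smul := fun π p => ⟨π • p.1, by
        change f (π • p.1.1) = f (π • p.1.2)
        rw [hom_smul, hom_smul, p.2]⟩
      one_smul := fun p => Subtype.ext (one_smul _ p.1)
      mul_smul := fun π σ p => Subtype.ext (mul_smul π σ p.1) }
  { carrier := {p : X × X // f p.1 = f p.2}
    finSupported := fun p => by
      classical
      obtain ⟨S, hS⟩ := X.finSupported p.1.1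
      obtain ⟨R, hR⟩ := X.finSupported p.1.2
      exact ⟨S ∪ R, fun π hπ => Subtype.ext (Prod.ext
        (hS π fun a ha => hπ (by simp_all)) (hR π fun a ha => hπ (by simp_all)))⟩ }

/-- The two projections of the kernel pair agree after `f`, hence agree. This lets elements be
compared under `F.map (incl s)`. -/
theorem injective_of_mono {X Y : Nom.{v, u} V} (f : X ⟶ Y) [Mono f] :
    Function.Injective f := by
  intro x y h
  let a : kerPair f ⟶ X := ⟨{ toFun := fun p => p.1.1, map_smul' := fun _ _ => rfl }⟩
  let b : kerPair f ⟶ X := ⟨{ toFun := fun p => p.1.2, map_smul' := fun _ _ => rfl }⟩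
  have hab : a = b := (cancel_mono f).1 (hom_ext fun p => p.2)
  exact hom_congr hab (⟨(x, y), h⟩ : {p : X × X // f p.1 = f p.2})

/-- A functional equivariant relation is an equivariant map. -/
theorem exists_hom_of_rel {X Y : Nom.{v, u} V} (R : X → Y → Prop) (hR : ∀ x, ∃! y, R x y)
    (hsmul : ∀ (π : FinPerm V) x y, R x y → R (π • x) (π • y)) :
    ∃ f : X ⟶ Y, ∀ x, R x (f x) := by
  choose f hf hu using hR
  exact ⟨⟨{ toFun := f, map_smul' := fun π x => (hu _ _ (hsmul π _ _ (hf x))).symm }⟩, hf⟩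

/-- A map whose values lie in the image of a monomorphism factors through it. -/
theorem exists_factor {X Y Z : Nom.{v, u} V} (g : X ⟶ Z) (m : Y ⟶ Z) [Mono m]
    (h : ∀ x, ∃ y, m y = g x) : ∃ k : X ⟶ Y, k ≫ m = g := by
  obtain ⟨k, hk⟩ := exists_hom_of_rel (fun x y => m y = g x)
    (fun x => by
      obtain ⟨y, hy⟩ := h x
      exact ⟨y, hy, fun z hz => injective_of_mono m (hz.trans hy.symm)⟩)
    (fun π x y e => by rw [hom_smul, hom_smul, e])
  exact ⟨k, hom_ext hk⟩

/-! ### The final coalgebra as limit of the final sequence -/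

section FinalCoalgebra

variable (F : Nom.{v, u} V ⥤ Nom.{v, u} V)

/-- The connecting maps of the final sequence. -/
def finalMap : ∀ n : ℕ, finalSeq F (n + 1) ⟶ finalSeq F n
  | 0 => toOne _
  | n + 1 => F.map (finalMap n)

/-- The final sequence as an `ω`-op-chain. -/
abbrev finalChain : ℕᵒᵖ ⥤ Nom.{v, u} V := Functor.ofOpSequence (finalMap F)

variable {F} in
theorem finalChain_map (n : ℕ) :
    (finalChain F).map (homOfLE (Nat.le_succ n)).op = finalMap F n :=
  Functor.ofOpSequence_map_homOfLE_succ _ n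

/-- The limit of the final sequence in nominal sets: finitely supported compatible sequences. -/
def finalLim : Nom.{v, u} V :=
  letI : MulAction (FinPerm V) {x : ∀ n, finalSeq F n //
      (∀ n, finalMap F n (x (n + 1)) = x n) ∧ IsFinSupported V x} :=
    { smul := fun π x => ⟨π • x.1, fun n => by
        change finalMap F n (π • x.1 (n + 1)) = π • x.1 n
        rw [hom_smul, x.2.1], x.2.2.smul π⟩
      one_smul := fun x => Subtype.ext (one_smul _ x.1)
      mul_smul := fun π σ x => Subtype.ext (mul_smul π σ x.1) }
  { carrier := {x : ∀ n, finalSeq F n //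
      (∀ n, finalMap F n (x (n + 1)) = x n) ∧ IsFinSupported V x}
    finSupported := fun x => by
      obtain ⟨S, hS⟩ := x.2.2
      exact ⟨S, fun π hπ => Subtype.ext (hS π hπ)⟩ }

/-- The projections of the limit of the final sequence. -/
def finalπ (n : ℕ) : finalLim F ⟶ finalSeq F n :=
  ⟨{ toFun := fun x => x.1 n, map_smul' := fun _ _ => rfl }⟩

theorem finalπ_comp (n : ℕ) : finalπ F (n + 1) ≫ finalMap F n = finalπ F n :=
  hom_ext fun x => x.2.1 n

variable {F} in
theorem finalLim_ext {x y : finalLim F} (h : ∀ n, finalπ F n x = finalπ F n y) : x = y :=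
  Subtype.ext (funext h)

variable {F} in
/-- The universal map into the limit of the final sequence. -/
def finalLift {X : Nom.{v, u} V} (q : ∀ n, X ⟶ finalSeq F n)
    (hq : ∀ n, q (n + 1) ≫ finalMap F n = q n) : X ⟶ finalLim F :=
  ⟨{ toFun := fun x => ⟨fun n => q n x, fun n => hom_congr (hq n) x, by
        -- A single support of `x` serves all coordinates at once.
        obtain ⟨S, hS⟩ := X.finSupported x
        exact ⟨S, fun π hπ => funext fun n => supports_hom (q n) hS π hπ⟩⟩
     map_smul' := fun π x => Subtype.ext (funext fun n => hom_smul (q n) π x) }⟩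

theorem finalLift_π {X : Nom.{v, u} V} (q : ∀ n, X ⟶ finalSeq F n)
    (hq : ∀ n, q (n + 1) ≫ finalMap F n = q n) (n : ℕ) :
    finalLift q hq ≫ finalπ F n = q n := rfl

/-- A compatible family of maps into a chain indexed by the natural numbers, as a cone. -/
def opSeqCone (D : ℕᵒᵖ ⥤ Nom.{v, u} V) (X : Nom.{v, u} V) (q : ∀ n : ℕ, X ⟶ D.obj ⟨n⟩)
    (hq : ∀ n, q (n + 1) ≫ D.map (homOfLE (Nat.le_succ n)).op = q n) : Cone D where
  pt := X
  π := NatTrans.ofOpSequence q fun n => by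
    rw [hq]
    exact Category.id_comp _

/-- The limit cone of the final sequence. -/
def finalCone : Cone (finalChain F) :=
  opSeqCone (finalChain F) (finalLim F) (finalπ F) fun n => by
    rw [finalChain_map]
    exact finalπ_comp F n

/-- The cone of finitely supported compatible sequences is a limit. -/
def finalConeIsLimit : IsLimit (finalCone F) where
  lift s := finalLift (fun n => s.π.app ⟨n⟩) fun n => by
    rw [← finalChain_map]
    exact s.w (homOfLE (Nat.le_succ n)).op
  fac s j := rfl
  uniq s m hm := hom_ext fun x => finalLim_ext fun n => hom_congr (hm ⟨n⟩) x

theorem proj_comp_finalMap (C : Endofunctor.Coalgebra F) (n : ℕ) :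
    proj C (n + 1) ≫ finalMap F n = proj C n := by
  induction n with
  | zero => rfl
  | succ n ih =>
    change (C.str ≫ F.map (proj C (n + 1))) ≫ F.map (finalMap F n) = C.str ≫ F.map (proj C n)
    rw [Category.assoc, ← F.map_comp, ih]

theorem hom_comp_proj {C D : Endofunctor.Coalgebra F} (h : C ⟶ D) (n : ℕ) :
    h.f ≫ proj D n = proj C n := by
  induction n with
  | zero => rfl
  | succ n ih =>
    change h.f ≫ D.str ≫ F.map (proj D n) = C.str ≫ F.map (proj C n)
    rw [← Category.assoc, ← h.h, Category.assoc, ← F.map_comp, ih]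

variable [PreservesLimitsOfShape ℕᵒᵖ F]

variable {F} in
theorem map_finalπ_ext {X : Nom.{v, u} V} {f g : X ⟶ F.obj (finalLim F)}
    (h : ∀ n, f ≫ F.map (finalπ F n) = g ≫ F.map (finalπ F n)) : f = g :=
  (isLimitOfPreserves F (finalConeIsLimit F)).hom_ext fun j => h j.unop

/-- Applying `F` to the final sequence shifts it by one, so the projections from index 1 on form a
cone over the image chain, whose limit is `F` of the limit. -/
theorem exists_finalStr : ∃ τ : finalLim F ⟶ F.obj (finalLim F),
    ∀ n, τ ≫ F.map (finalπ F n) = finalπ F (n + 1) := by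
  let c : Cone (finalChain F ⋙ F) :=
    opSeqCone (finalChain F ⋙ F) (finalLim F) (fun n => finalπ F (n + 1)) fun n => by
      rw [Functor.comp_map, finalChain_map]
      exact finalπ_comp F (n + 1)
  exact ⟨(isLimitOfPreserves F (finalConeIsLimit F)).lift c, fun n =>
    (isLimitOfPreserves F (finalConeIsLimit F)).fac c ⟨n⟩⟩

/-- The coalgebra structure on the limit of the final sequence. -/
noncomputable def finalStr : finalLim F ⟶ F.obj (finalLim F) :=
  (exists_finalStr F).choose

theorem finalStr_map (n : ℕ) : finalStr F ≫ F.map (finalπ F n) = finalπ F (n + 1) :=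
  (exists_finalStr F).choose_spec n

/-- The limit of the final sequence as a coalgebra. -/
noncomputable def finalCoalg : Endofunctor.Coalgebra F where
  V := finalLim F
  str := finalStr F

theorem finalLift_proj_str (C : Endofunctor.Coalgebra F) :
    C.str ≫ F.map (finalLift (proj C) (proj_comp_finalMap F C)) =
      finalLift (proj C) (proj_comp_finalMap F C) ≫ finalStr F :=
  map_finalπ_ext fun n => by
    rw [Category.assoc, Category.assoc, finalStr_map, ← F.map_comp, finalLift_π]
    rfl

theorem proj_finalCoalg (n : ℕ) : proj (finalCoalg F) n = finalπ F n := by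
  induction n with
  | zero => rfl
  | succ n ih =>
    change finalStr F ≫ F.map (proj (finalCoalg F) n) = _
    rw [ih]
    exact finalStr_map F n

/-- The limit of the final sequence is the final coalgebra. -/
noncomputable def finalCoalgIsTerminal : IsTerminal (finalCoalg F) :=
  IsTerminal.ofUniqueHom
    (fun C =>
      { f := finalLift (proj C) (proj_comp_finalMap F C)
        h := finalLift_proj_str F C })
    (fun C m => by
      ext1
      refine hom_ext fun x => finalLim_ext fun n => ?_
      have h := hom_congr (hom_comp_proj F m n) x
      rw [proj_finalCoalg] at h
      exact h)

end FinalCoalgebra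

/-! ### The initial algebra as a maximal recursive subcoalgebra -/

section InitialAlgebra

variable {F : Nom.{v, u} V ⥤ Nom.{v, u} V}

/-- A coalgebra is recursive if it has exactly one coalgebra-to-algebra map into every algebra. -/
def IsRecursive {A : Nom.{v, u} V} (α : A ⟶ F.obj A) : Prop :=
  ∀ B : Endofunctor.Algebra F, ∃! h : A ⟶ B.a, h = α ≫ F.map h ≫ B.str

/-- A nominal subset carrying a recursive subcoalgebra. -/
def IsRecursiveSub {T : Nom.{v, u} V} (τ : T ⟶ F.obj T) (s : SubMulAction (FinPerm V) T) : Prop :=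
  ∃ α : sub T s ⟶ F.obj (sub T s), α ≫ F.map (incl s) = incl s ≫ τ ∧ IsRecursive α

/-- The union of a family of nominal subsets. -/
def iUnionSub {T : Nom.{v, u} V} (c : Set (SubMulAction (FinPerm V) T)) :
    SubMulAction (FinPerm V) T where
  carrier := {x | ∃ s ∈ c, x ∈ s}
  smul_mem' := fun π _ ⟨s, hs, hx⟩ => ⟨s, hs, s.smul_mem π hx⟩

theorem le_iUnionSub {T : Nom.{v, u} V} {c : Set (SubMulAction (FinPerm V) T)}
    {s : SubMulAction (FinPerm V) T} (hs : s ∈ c) : s ≤ iUnionSub c :=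
  fun _ hx => ⟨s, hs, hx⟩

/-- Recursive subcoalgebras are closed under unions of chains. -/
theorem isRecursiveSub_iUnionSub [F.PreservesMonomorphisms] {T : Nom.{v, u} V}
    {τ : T ⟶ F.obj T} {c : Set (SubMulAction (FinPerm V) T)} (hchain : IsChain (· ≤ ·) c)
    (hc : ∀ s ∈ c, IsRecursiveSub τ s) : IsRecursiveSub τ (iUnionSub c) := by
  choose α hα hrec using hc
  -- Each point lies in some member `s`, where `α s` already places its structure in the image of `F
  -- s`.
  obtain ⟨β, hβ⟩ := exists_factor (incl (iUnionSub c) ≫ τ) (F.map (incl (iUnionSub c)))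
    (fun x => by
      obtain ⟨s, hs, hx⟩ := x.2
      refine ⟨F.map (inclLE (le_iUnionSub hs)) (α s hs (⟨x.1, hx⟩ : s)), ?_⟩
      refine Eq.trans ?_ (hom_congr (hα s hs) (⟨x.1, hx⟩ : s))
      exact (hom_congr (F.map_comp (inclLE (le_iUnionSub hs)) (incl _)) _).symm)
  have key : ∀ s (hs : s ∈ c), inclLE (le_iUnionSub hs) ≫ β =
      α s hs ≫ F.map (inclLE (le_iUnionSub hs)) := fun s hs => by
    rw [← cancel_mono (F.map (incl (iUnionSub c))), Category.assoc, hβ, Category.assoc,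
      ← F.map_comp, inclLE_incl, hα s hs, ← Category.assoc, inclLE_incl]
  refine ⟨β, hβ, fun B => ?_⟩
  choose h hh huniq using fun s hs => hrec s hs B
  replace hh : ∀ s hs, h s hs = α s hs ≫ F.map (h s hs) ≫ B.str := hh
  -- The restriction to `s` of the solution on `t` solves the equation on `s`, so uniqueness
  -- identifies them and the solutions glue.
  have hcompat : ∀ s (hs : s ∈ c) t (ht : t ∈ c), ∀ hst : s ≤ t, inclLE hst ≫ h t ht = h s hs := by
    intro s hs t ht hst
    apply huniq s hs
    change inclLE hst ≫ h t ht = α s hs ≫ F.map (inclLE hst ≫ h t ht) ≫ B.str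
    have e : inclLE hst ≫ α t ht = α s hs ≫ F.map (inclLE hst) := by
      rw [← cancel_mono (F.map (incl t)), Category.assoc, hα t ht, Category.assoc,
        ← F.map_comp, inclLE_incl, hα s hs, ← Category.assoc, inclLE_incl]
    conv_lhs => rw [hh t ht]
    rw [← Category.assoc, e, F.map_comp, Category.assoc, Category.assoc]
  have hagree : ∀ s (hs : s ∈ c) t (ht : t ∈ c), ∀ (x : T) (hxs : x ∈ s) (hxt : x ∈ t),
      h s hs (⟨x, hxs⟩ : s) = h t ht (⟨x, hxt⟩ : t) := by
    intro s hs t ht x hxs hxt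
    rcases hchain.total hs ht with hst | hst
    · rw [← hcompat s hs t ht hst]
      rfl
    · rw [← hcompat t ht s hs hst]
      rfl
  obtain ⟨k, hk⟩ := exists_hom_of_rel
    (X := sub T (iUnionSub c)) (Y := B.a)
    (fun x y => ∃ s, ∃ hs : s ∈ c, ∃ hx : x.1 ∈ s, h s hs (⟨x.1, hx⟩ : s) = y)
    (fun x => by
      obtain ⟨s, hs, hx⟩ := x.2
      refine ⟨_, ⟨s, hs, hx, rfl⟩, ?_⟩
      rintro _ ⟨t, ht, hxt, rfl⟩
      exact hagree t ht s hs _ hxt hx)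
    (by
      rintro π x _ ⟨s, hs, hx, rfl⟩
      exact ⟨s, hs, s.smul_mem π hx, hom_smul (h s hs) π (⟨x.1, hx⟩ : s)⟩)
  have hk' : ∀ s (hs : s ∈ c), inclLE (le_iUnionSub hs) ≫ k = h s hs := by
    refine fun s hs => hom_ext fun x => ?_
    obtain ⟨t, ht, hx, e⟩ := hk (inclLE (le_iUnionSub hs) x)
    exact e.symm.trans (hagree t ht s hs _ hx x.2)
  have glue : ∀ f g : sub T (iUnionSub c) ⟶ B.a,
      (∀ s (hs : s ∈ c), inclLE (le_iUnionSub hs) ≫ f = inclLE (le_iUnionSub hs) ≫ g) →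
        f = g := by
    refine fun f g hfg => hom_ext fun x => ?_
    obtain ⟨s, hs, hx⟩ := x.2
    exact hom_congr (hfg s hs) (⟨x.1, hx⟩ : s)
  refine ⟨k, glue _ _ fun s hs => ?_, fun g hg => glue _ _ fun s hs => ?_⟩
  · rw [← Category.assoc, key s hs, Category.assoc, ← Category.assoc (F.map _), ← F.map_comp,
      hk' s hs]
    exact hh s hs
  · rw [hk' s hs]
    apply huniq s hs
    change _ = α s hs ≫ F.map (inclLE (le_iUnionSub hs) ≫ g) ≫ B.str
    conv_lhs => rw [hg]
    rw [← Category.assoc, key s hs, F.map_comp, Category.assoc, Category.assoc]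

/-- The states whose structure lies in the image of `F s`. -/
def nextSub {T : Nom.{v, u} V} (τ : T ⟶ F.obj T) (s : SubMulAction (FinPerm V) T) :
    SubMulAction (FinPerm V) T where
  carrier := {x | ∃ z, F.map (incl s) z = τ x}
  smul_mem' := fun π x ⟨z, hz⟩ => ⟨π • z, by rw [hom_smul, hom_smul, hz]⟩

theorem IsRecursiveSub.le_nextSub {T : Nom.{v, u} V} {τ : T ⟶ F.obj T}
    {s : SubMulAction (FinPerm V) T} (hs : IsRecursiveSub τ s) : s ≤ nextSub τ s := by
  obtain ⟨α, hα, -⟩ := hs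
  exact fun x hx => ⟨α (⟨x, hx⟩ : s), hom_congr hα (⟨x, hx⟩ : s)⟩

/-- One step of `τ` leads into `F s`, through `e`. So a solution is determined by its restriction to
`s`, and the solution `h` on `s` extends as `e ≫ F.map h ≫ B.str`. -/
theorem IsRecursiveSub.nextSub [F.PreservesMonomorphisms] {T : Nom.{v, u} V} {τ : T ⟶ F.obj T}
    {s : SubMulAction (FinPerm V) T} (hs : IsRecursiveSub τ s) :
    IsRecursiveSub τ (nextSub τ s) := by
  have hle := hs.le_nextSub
  obtain ⟨α, hα, hrec⟩ := hs
  obtain ⟨e, he⟩ := exists_factor (incl (Nom.nextSub τ s) ≫ τ) (F.map (incl s)) fun x => x.2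
  have hk : inclLE hle ≫ e = α := by
    rw [← cancel_mono (F.map (incl s)), Category.assoc, he, hα, ← Category.assoc, inclLE_incl]
  refine ⟨e ≫ F.map (inclLE hle), ?_, fun B => ?_⟩
  · rw [Category.assoc, ← F.map_comp, inclLE_incl, he]
  · obtain ⟨h, hh, huniq⟩ := hrec B
    refine ⟨e ≫ F.map h ≫ B.str, ?_, fun g hg => ?_⟩
    · change e ≫ F.map h ≫ B.str = (e ≫ F.map (inclLE hle)) ≫ F.map (e ≫ F.map h ≫ B.str) ≫ B.str
      have : inclLE hle ≫ e ≫ F.map h ≫ B.str = h := by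
        rw [← Category.assoc, hk]
        exact hh.symm
      rw [Category.assoc, ← Category.assoc (F.map (inclLE hle)), ← F.map_comp, this]
    · have hg' : g = e ≫ F.map (inclLE hle ≫ g) ≫ B.str := by
        rw [F.map_comp, Category.assoc]
        exact hg.trans (Category.assoc _ _ _)
      have : inclLE hle ≫ g = h := by
        apply huniq
        conv_lhs => rw [hg']
        rw [← Category.assoc, hk]
      rw [this] at hg'
      exact hg'

/-- A fixed point of a mono-preserving functor contains an initial algebra. -/
theorem exists_initial_algebra [F.PreservesMonomorphisms] {T : Nom.{v, u} V} (τ : T ⟶ F.obj T)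
    [IsIso τ] : ∃ (I : Endofunctor.Algebra F) (ι : I.a ⟶ T), Nonempty (IsInitial I) ∧
      Function.Injective ι ∧ I.str ≫ ι ≫ τ = F.map ι := by
  -- The empty chain is included: its union is the empty subcoalgebra, so no starting point is
  -- needed.
  obtain ⟨s, hs⟩ := zorn_le₀ {s | IsRecursiveSub τ s} fun c hc hchain =>
    ⟨iUnionSub c, isRecursiveSub_iUnionSub hchain hc, fun s hs => le_iUnionSub hs⟩
  have hmax : nextSub τ s ≤ s := hs.le_of_ge hs.prop.nextSub hs.prop.le_nextSub
  obtain ⟨α, hα, hrec⟩ := hs.prop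
  let σ : F.obj (sub T s) ⟶ sub T s := codRestrict s (F.map (incl s) ≫ inv τ) fun z =>
    hmax ⟨z, by rw [← comp_app, Category.assoc, IsIso.inv_hom_id, Category.comp_id]⟩
  have hσ : σ ≫ incl s = F.map (incl s) ≫ inv τ := rfl
  have hστ : σ ≫ incl s ≫ τ = F.map (incl s) := by
    rw [← Category.assoc, hσ, Category.assoc, IsIso.inv_hom_id, Category.comp_id]
  have h1 : σ ≫ α = 𝟙 _ := by
    rw [← cancel_mono (F.map (incl s)), Category.assoc, hα, hστ, Category.id_comp]
  have h2 : α ≫ σ = 𝟙 _ := by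
    rw [← cancel_mono (incl s), Category.assoc, hσ, ← Category.assoc, hα, Category.assoc,
      IsIso.hom_inv_id, Category.comp_id, Category.id_comp]
  -- As `α` and `σ` are mutually inverse, coalgebra-to-algebra maps out of `α` are exactly algebra
  -- homomorphisms out of `σ`.
  refine ⟨⟨sub T s, σ⟩, incl s, ⟨IsInitial.ofUniqueHom
    (fun B => ⟨(hrec B).choose, ?_⟩) fun B m => ?_⟩, incl_injective s, hστ⟩
  · have := (hrec B).choose_spec.1
    change F.map _ ≫ B.str = σ ≫ _
    conv_rhs => rw [this]
    rw [← Category.assoc, h1, Category.id_comp]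
  · ext1
    apply (hrec B).choose_spec.2
    change m.f = α ≫ F.map m.f ≫ B.str
    rw [m.h, ← Category.assoc, h2, Category.id_comp]

end InitialAlgebra

/-! ### The metric given by the projections, and completeness -/

section Metric

/-- Jointly injective projections, each refining the previous one, induce a metric. -/
theorem exists_projMetric {T : Type u} {E : ℕ → Type u} (p : ∀ n, T → E n)
    (h0 : ∀ x y, p 0 x = p 0 y) (hsucc : ∀ n x y, p (n + 1) x = p (n + 1) y → p n x = p n y)
    (hsep : ∀ x y, (∀ n, p n x = p n y) → x = y) :
    ∃ _ : MetricSpace T, ∀ x y : T, x ≠ y → ∃ m : ℕ,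
      IsGreatest {n : ℕ | p n x = p n y} m ∧ dist x y = (2 : ℝ)⁻¹ ^ m := by
  -- Level 0 is dropped since `p 0` separates nothing. With this shift, the first index where `q x`
  -- and `q y` differ is the last level where `p` agrees.
  let _ : ∀ n, TopologicalSpace (E (n + 1)) := fun _ => ⊥
  have : ∀ n, DiscreteTopology (E (n + 1)) := fun _ => ⟨rfl⟩
  let _ : MetricSpace (∀ n, E (n + 1)) := PiNat.metricSpace
  let q : T → ∀ n, E (n + 1) := fun x n => p (n + 1) x
  have hq : Function.Injective q := fun x y h => hsep x y fun n => by
    cases n with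
    | zero => exact h0 x y
    | succ n => exact congrFun h n
  refine ⟨MetricSpace.induced q hq inferInstance, fun x y hxy => ?_⟩
  have hne : q x ≠ q y := hq.ne hxy
  refine ⟨PiNat.firstDiff (q x) (q y), ⟨?_, fun n hn => ?_⟩, ?_⟩
  · rcases h : PiNat.firstDiff (q x) (q y) with _ | k
    · exact h0 x y
    · exact PiNat.apply_eq_of_lt_firstDiff (x := q x) (y := q y) (n := k) (by omega)
  · by_contra! hlt
    exact PiNat.apply_firstDiff_ne hne
      (Nat.decreasingInduction' (P := fun k => p k x = p k y) (fun k _ _ => hsucc k x y) hlt hn)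
  · rw [← one_div]
    exact PiNat.dist_eq_of_ne hne

variable {T : Nom.{v, u} V} {E : ℕ → Nom.{v, u} V} {p : ∀ n, T ⟶ E n} [MetricSpace T]

/-- The levels of agreement are downward closed. Completeness and density use the metric only in
this form. -/
theorem dist_le_iff_proj (hsucc : ∀ n x y, p (n + 1) x = p (n + 1) y → p n x = p n y)
    (hd : ∀ x y : T, x ≠ y → ∃ m : ℕ,
      IsGreatest {n : ℕ | p n x = p n y} m ∧ dist x y = (2 : ℝ)⁻¹ ^ m) (x y : T) (n : ℕ) :
    dist x y ≤ (2 : ℝ)⁻¹ ^ n ↔ p n x = p n y := by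
  by_cases hxy : x = y
  · subst hxy
    simp
  obtain ⟨m, hm, h⟩ := hd x y hxy
  rw [h, pow_le_pow_iff_right_of_lt_one₀ (by norm_num) (by norm_num)]
  exact ⟨fun hnm => Nat.decreasingInduction' (fun k _ _ => hsucc k x y) hnm hm.1,
    fun h => hm.2 h⟩

theorem isNominalMetric_of_proj
    (hd : ∀ x y : T, x ≠ y → ∃ m : ℕ,
      IsGreatest {n : ℕ | p n x = p n y} m ∧ dist x y = (2 : ℝ)⁻¹ ^ m) : IsNominalMetric T where
  dist_le_one x y := by
    by_cases hxy : x = y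
    · subst hxy
      simp
    obtain ⟨m, -, h⟩ := hd x y hxy
    rw [h]
    exact pow_le_one₀ (by norm_num) (by norm_num)
  dist_smul π x y := by
    by_cases hxy : x = y
    · subst hxy
      simp
    obtain ⟨m, hm, h⟩ := hd x y hxy
    obtain ⟨k, hk, h'⟩ := hd (π • x) (π • y) fun e => hxy (smul_left_cancel π e)
    have : {n : ℕ | p n (π • x) = p n (π • y)} = {n : ℕ | p n x = p n y} := by
      ext n
      simp only [Set.mem_ofPred_eq, hom_smul, smul_left_cancel_iff]
    rw [this] at hk
    rw [h, h', hm.unique hk]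

/-- Every coordinate of a Cauchy sequence is eventually constant, and the stable values form a
compatible sequence. The common support of the terms makes it finitely supported. -/
theorem isNominalComplete_finalLim (F : Nom.{v, u} V ⥤ Nom.{v, u} V) [MetricSpace (finalLim F)]
    (hd : ∀ (x y : finalLim F) n,
      dist x y ≤ (2 : ℝ)⁻¹ ^ n ↔ finalπ F n x = finalπ F n y) :
    IsNominalComplete (finalLim F) := by
  rintro x ⟨hx, S, hS⟩
  have hN : ∀ n, ∃ N, ∀ k ≥ N, finalπ F n (x k) = finalπ F n (x N) := fun n => by
    obtain ⟨N, hN⟩ := Metric.cauchySeq_iff'.1 hx ((2 : ℝ)⁻¹ ^ n) (by positivity)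
    exact ⟨N, fun k hk => (hd _ _ n).1 (hN k hk).le⟩
  choose N hN using hN
  let l : finalLim F := (⟨fun n => finalπ F n (x (N n)), fun n => by
      have h1 := hN n _ (le_max_left (N n) (N (n + 1)))
      have h2 := hN (n + 1) _ (le_max_right (N n) (N (n + 1)))
      refine (congrArg (finalMap F n) h2.symm).trans (Eq.trans ?_ h1)
      exact hom_congr (finalπ_comp F n) _,
    S, fun π hπ => funext fun n => supports_hom (finalπ F n) (hS (N n)) π hπ⟩ :
      {x : ∀ n, finalSeq F n // (∀ n, finalMap F n (x (n + 1)) = x n) ∧ IsFinSupported V x})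
  refine ⟨l, Metric.tendsto_atTop.2 fun ε hε => ?_⟩
  obtain ⟨n, hn⟩ := exists_pow_lt_of_lt_one hε (by norm_num : (2 : ℝ)⁻¹ < 1)
  exact ⟨N n, fun k hk => ((hd _ l n).2 (hN n k hk)).trans_lt hn⟩

end Metric

/-! ### Extension of uniformly continuous equivariant maps -/

section Completion

variable {X Y Z : Nom.{v, u} V} [MetricSpace X] [MetricSpace Y] [MetricSpace Z]

theorem IsNominalMetric.tendsto_smul (h : IsNominalMetric X) (π : FinPerm V) {x : ℕ → X} {l : X}
    (hx : Tendsto x atTop (𝓝 l)) : Tendsto (fun n => π • x n) atTop (𝓝 (π • l)) := by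
  rw [tendsto_iff_dist_tendsto_zero] at hx ⊢
  simpa only [h.dist_smul] using hx

/-- Uniformly continuous equivariant maps extend uniquely along isometries with sequentially dense
image. -/
theorem exists_unique_extension_of_isometry (hY : IsNominalMetric Y) (hZ : IsNominalMetric Z)
    (hZc : IsNominalComplete Z) {ι : X ⟶ Y} (hι : Isometry ι)
    (hseq : ∀ y : Y, ∃ x : ℕ → X, IsFinSupportedCauchySeq x ∧
      Tendsto (fun n => ι (x n)) atTop (𝓝 y))
    (f : X ⟶ Z) (hf : UniformContinuous f) :
    ∃! g : Y ⟶ Z, UniformContinuous g ∧ ι ≫ g = f := by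
  choose s hs hlim using hseq
  have hex : ∀ y, ∃ z, Tendsto (fun n => f (s y n)) atTop (𝓝 z) := fun y => by
    refine hZc _ ⟨hf.comp_cauchySeq (hs y).1, ?_⟩
    obtain ⟨S, hS⟩ := (hs y).2
    exact ⟨S, fun n => supports_hom f (hS n)⟩
  choose g hg using hex
  -- The modulus of continuity passes to limits along arbitrary approximating sequences. The choice
  -- of `s y` is not equivariant in `y`, so `hsmul` needs this independence of the sequence.
  have key : ∀ ε > 0, ∃ δ > 0, ∀ (a b : ℕ → X) (y y' : Y) (z z' : Z),
      Tendsto (fun n => ι (a n)) atTop (𝓝 y) → Tendsto (fun n => ι (b n)) atTop (𝓝 y') →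
      Tendsto (fun n => f (a n)) atTop (𝓝 z) → Tendsto (fun n => f (b n)) atTop (𝓝 z') →
      dist y y' < δ → dist z z' ≤ ε := by
    intro ε hε
    obtain ⟨δ, hδ, h⟩ := Metric.uniformContinuous_iff.1 hf ε hε
    refine ⟨δ, hδ, fun a b y y' z z' ha hb hfa hfb hd => ?_⟩
    refine le_of_tendsto (hfa.dist hfb) ?_
    filter_upwards [(ha.dist hb).eventually (gt_mem_nhds hd)] with n hn
    rw [hι.dist_eq] at hn
    exact (h hn).le
  have key' : ∀ (a b : ℕ → X) (y : Y) (z z' : Z),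
      Tendsto (fun n => ι (a n)) atTop (𝓝 y) → Tendsto (fun n => ι (b n)) atTop (𝓝 y) →
      Tendsto (fun n => f (a n)) atTop (𝓝 z) → Tendsto (fun n => f (b n)) atTop (𝓝 z') →
      z = z' := fun a b y z z' ha hb hfa hfb =>
    eq_of_forall_dist_le fun ε hε => by
      obtain ⟨δ, hδ, h⟩ := key ε hε
      exact h a b y y z z' ha hb hfa hfb (by rwa [dist_self])
  have hsmul : ∀ (π : FinPerm V) y, g (π • y) = π • g y := fun π y => by
    refine key' (s (π • y)) (fun n => π • s y n) (π • y) _ _ (hlim _) ?_ (hg _) ?_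
    · simpa only [hom_smul] using hY.tendsto_smul π (hlim y)
    · simpa only [hom_smul] using hZ.tendsto_smul π (hg y)
  let G : Y ⟶ Z := ⟨{ toFun := g, map_smul' := hsmul }⟩
  refine ⟨G, ⟨Metric.uniformContinuous_iff.2 fun ε hε => ?_, hom_ext fun x => ?_⟩, ?_⟩
  · obtain ⟨δ, hδ, h⟩ := key (ε / 2) (half_pos hε)
    exact ⟨δ, hδ, fun y y' hd => (h _ _ y y' _ _ (hlim y) (hlim y') (hg y) (hg y') hd).trans_lt
      (half_lt_self hε)⟩
  · exact key' (s (ι x)) (fun _ => x) (ι x) _ _ (hlim _) tendsto_const_nhds (hg _)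
      tendsto_const_nhds
  · rintro g' ⟨hg', rfl⟩
    exact hom_ext fun y => tendsto_nhds_unique ((hg'.continuous.tendsto y).comp (hlim y)) (hg y)

end Completion

/-! ### Approximation by finitely supported sections -/

section Density

variable {F : Nom.{v, u} V ⥤ Nom.{v, u} V}

/-- Post-composition with an equivariant map preserves supports. -/
theorem supports_ihomComp_ofHom {X Y Z : Nom.{v, u} V} (g : Y ⟶ Z) {f : ihom X Y} {S : Set V}
    (h : MulAction.Supports (FinPerm V) S f) :
    MulAction.Supports (FinPerm V) S (ihomComp (ihomOfHom g) f) := fun π hπ => by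
  refine Subtype.ext (funext fun x => ?_)
  have h1 : π • f.1 (π⁻¹ • x) = f.1 x := congrFun (congrArg Subtype.val (h π hπ)) x
  change π • g (f.1 (π⁻¹ • x)) = g (f.1 x)
  rw [← hom_smul, h1]

/-- Values of a finitely supported function are supported by the union of the supports. -/
theorem supports_apply {X Y : Nom.{v, u} V} {f : ihom X Y} {x : X} {S R : Set V}
    (hf : MulAction.Supports (FinPerm V) S f) (hx : MulAction.Supports (FinPerm V) R x) :
    MulAction.Supports (FinPerm V) (S ∪ R) (f.1 x) := fun π hπ => by
  have h1 : π • f.1 (π⁻¹ • x) = f.1 x :=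
    congrFun (congrArg Subtype.val (hf π fun a ha => hπ (Or.inl ha))) x
  have h2 : π⁻¹ • x = x := inv_smul_eq_iff.2 (hx π fun a ha => hπ (Or.inr ha)).symm
  rwa [h2] at h1

/-- The finitely supported maps `Fⁿ 1 → I` obtained by iterating `F` on an element of an
algebra. -/
def algSection (H : Enrichment F) (I : Endofunctor.Algebra F) (a : I.a) :
    ∀ n, ihom (finalSeq F n) I.a
  | 0 => ⟨fun _ => a, by
      obtain ⟨S, hS⟩ := I.a.finSupported a
      exact ⟨S, fun π hπ => funext fun _ => hS π hπ⟩⟩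
  | n + 1 => ihomComp (ihomOfHom I.str) (H.map _ _ (algSection H I a n))

theorem supports_algSection (H : Enrichment F) (I : Endofunctor.Algebra F) {a : I.a} {S : Set V}
    (hS : MulAction.Supports (FinPerm V) S a) (n : ℕ) :
    MulAction.Supports (FinPerm V) S (algSection H I a n) := by
  induction n with
  | zero => exact fun π hπ => Subtype.ext (funext fun _ => hS π hπ)
  | succ n ih => exact supports_ihomComp_ofHom _ (supports_hom (H.map _ _) ih)

/-- Induction through `σ ≫ ι ≫ pₙ₊₁ = F (ι ≫ pₙ)`: the enriched `F` carries the identity at level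
`n` to the identity at level `n + 1`. At level 0 both sides are maps into a point. -/
theorem ihomComp_algSection (H : Enrichment F) {I : Endofunctor.Algebra F}
    {T : Endofunctor.Coalgebra F} {ι : I.a ⟶ T.V} (hι : I.str ≫ ι ≫ T.str = F.map ι) (a : I.a)
    (n : ℕ) : ihomComp (ihomOfHom (ι ≫ proj T n)) (algSection H I a n) = ihomOfHom (𝟙 _) := by
  induction n with
  | zero => rfl
  | succ n ih =>
    have e : I.str ≫ ι ≫ proj T (n + 1) = F.map (ι ≫ proj T n) := by
      change I.str ≫ ι ≫ T.str ≫ F.map (proj T n) = _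
      rw [F.map_comp, ← hι, Category.assoc, Category.assoc]
    have h1 : ihomComp (ihomOfHom (I.str ≫ ι ≫ proj T (n + 1)))
        (H.map _ _ (algSection H I a n)) =
          H.map _ _ (ihomComp (ihomOfHom (ι ≫ proj T n)) (algSection H I a n)) := by
      rw [e, H.map_comp, H.map_ofHom]
      rfl
    rw [ih, H.map_ofHom, F.map_id] at h1
    exact h1

theorem proj_algSection (H : Enrichment F) {I : Endofunctor.Algebra F}
    {T : Endofunctor.Coalgebra F} {ι : I.a ⟶ T.V} (hι : I.str ≫ ι ≫ T.str = F.map ι) (a : I.a)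
    (n : ℕ) (y : finalSeq F n) : proj T n (ι ((algSection H I a n).1 y)) = y :=
  congrFun (congrArg Subtype.val (ihomComp_algSection H hι a n)) y

theorem nonempty_obj_zero (hzero : IsEmpty (F.obj (zero V) ≅ zero V)) :
    Nonempty (F.obj (zero V)) := by
  by_contra hne
  rw [not_nonempty_iff] at hne
  exact hzero.false
    { hom := ⟨{ toFun := fun x => hne.elim x, map_smul' := fun _ x => hne.elim x }⟩
      inv := (zeroIsInitial V).to _
      hom_inv_id := hom_ext fun x => hne.elim x
      inv_hom_id := (zeroIsInitial V).hom_ext _ _ }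

/-- Elements of the coalgebra are limits of finitely supported sequences of the algebra. -/
theorem exists_seq_tendsto (H : Enrichment F) {I : Endofunctor.Algebra F}
    {T : Endofunctor.Coalgebra F} [MetricSpace I.a] [MetricSpace T.V] {ι : I.a ⟶ T.V}
    (hι : I.str ≫ ι ≫ T.str = F.map ι) (hiso : Isometry ι)
    (hd : ∀ (x y : T.V) n, dist x y ≤ (2 : ℝ)⁻¹ ^ n ↔ proj T n x = proj T n y) (a : I.a)
    (y : T.V) : ∃ x : ℕ → I.a, IsFinSupportedCauchySeq x ∧
      Tendsto (fun n => ι (x n)) atTop (𝓝 y) := by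
  classical
  -- The `n`-th term has the same `pₙ` as `y`, hence distance at most `2⁻ⁿ`.
  have hlim : Tendsto (fun n => ι ((algSection H I a n).1 (proj T n y))) atTop (𝓝 y) := by
    refine tendsto_iff_dist_tendsto_zero.2 (squeeze_zero (fun _ => dist_nonneg)
      (fun n => (hd _ _ n).2 (proj_algSection H hι a n _))
      (tendsto_pow_atTop_nhds_zero_of_lt_one (by norm_num) (by norm_num)))
  obtain ⟨S, hS⟩ := I.a.finSupported a
  obtain ⟨R, hR⟩ := T.V.finSupported y
  refine ⟨_, ⟨hiso.isUniformInducing.cauchy_map_iff.1 hlim.cauchySeq, S ∪ R, fun n => ?_⟩, hlim⟩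
  rw [Finset.coe_union]
  exact supports_apply (supports_algSection H I hS n) (supports_hom (proj T n) hR)

end Density

end Nom

/-! ### Assembly -/

theorem mainTheorem6 {V : Type v} [Countable V] [Infinite V]
    (F : Nom.{v, u} V ⥤ Nom.{v, u} V)
    (hlim : PreservesLimitsOfShape ℕᵒᵖ F)
    (hmono : F.PreservesMonomorphisms)
    (hzero : IsEmpty (F.obj (Nom.zero V) ≅ Nom.zero V))
    (henr : Nonempty (Nom.Enrichment F)) :
    ∃ (T : Endofunctor.Coalgebra F) (I : Endofunctor.Algebra F),
      Nonempty (IsTerminal T) ∧ Nonempty (IsInitial I) ∧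
      ∃ (_ : MetricSpace T.V) (_ : MetricSpace I.a) (ι : I.a ⟶ T.V),
        Nom.IsNominalMetric T.V ∧ Nom.IsNominalMetric I.a ∧
        (∀ x y : T.V, x ≠ y → ∃ m : ℕ,
          IsGreatest {n : ℕ | Nom.proj T n x = Nom.proj T n y} m ∧
            dist x y = (2 : ℝ)⁻¹ ^ m) ∧
        I.str ≫ ι ≫ T.str = F.map ι ∧
        Nom.IsNominalCompletion ι := by
  obtain ⟨H⟩ := henr
  let T := Nom.finalCoalg F
  have hT : IsTerminal T := Nom.finalCoalgIsTerminal F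
  have : IsIso T.str := Endofunctor.Coalgebra.Terminal.str_isIso hT
  obtain ⟨I, ι, hI, hinj, hι⟩ := Nom.exists_initial_algebra T.str
  have hsucc : ∀ n (x y : T.V), Nom.proj T (n + 1) x = Nom.proj T (n + 1) y →
      Nom.proj T n x = Nom.proj T n y := fun n x y h => by
    rw [← Nom.proj_comp_finalMap, Nom.comp_app, Nom.comp_app, h]
  obtain ⟨mT, hd⟩ := Nom.exists_projMetric (fun n => ⇑(Nom.proj T n)) (fun _ _ => rfl) hsucc
    fun x y h => Nom.finalLim_ext fun n => by
      rw [← Nom.proj_finalCoalg]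
      exact h n
  have hle := Nom.dist_le_iff_proj hsucc hd
  have hnT : Nom.IsNominalMetric T.V := Nom.isNominalMetric_of_proj hd
  let mI : MetricSpace I.a := MetricSpace.induced ι hinj mT
  have hiso : Isometry ι := fun _ _ => rfl
  -- The image of `z` under `F 0 → F I → I` is the base point of the approximating sections.
  obtain ⟨z⟩ := Nom.nonempty_obj_zero hzero
  have hseq := Nom.exists_seq_tendsto H hι hiso hle
    (I.str (F.map ((Nom.zeroIsInitial V).to I.a) z))
  refine ⟨T, I, ⟨hT⟩, hI, mT, mI, ι, hnT, ⟨fun x y => hnT.dist_le_one _ _, fun π x y => ?_⟩, hd,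
    hι, ⟨?_, hiso, hseq, fun Z _ hZ hZc f hf =>
      Nom.exists_unique_extension_of_isometry hnT hZ hZc hiso hseq f hf⟩⟩
  · rw [← hiso.dist_eq, Nom.hom_smul, Nom.hom_smul, hnT.dist_smul, hiso.dist_eq]
  · refine @Nom.isNominalComplete_finalLim _ F mT fun x y n => ?_
    rw [← Nom.proj_finalCoalg]
    exact hle x y n
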